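/- Let $n,p\ge 1$ be integers. For $d\ge 1$ let $\mathrm{d}s$ denote the surface area measure on the unit sphere $S^{d-1}=\{e\in\mathbb{R}^d : \|e\|=1\}$ (counting measure if $d=1$), where $\|\cdot\|$ is the Euclidean norm, and let $\Omega_d$ be its total mass. A function $g:\mathbb{R}^d\to\mathbb{R}\cup\{\infty\}$ is called *superharmonic* if it is lower semicontinuous, $g\not\equiv\infty$, and $$\frac{1}{\Omega_d}\int_{S^{d-1}} g(x+re)\,\mathrm{d}s(e)\le g(x)\qquad\text{for every } x\in\mathbb{R}^d \text{ and } r>0.$$ A function $f:\mathbb{R}^{n\times p}\to\mathbb{R}\cup\{\infty\}$ is called *matrix superharmonic* if it is lower semicontinuous, $f\not\equiv\infty$, and $$\frac{1}{\Omega_n}\int_{S^{n-1}} f(X+e\rho^{\top})\,\mathrm{d}s(e)\le f(X)\qquad\text{for every } X\in\mathbb{R}^{n\times p} \text{ and } \rho\in\mathbb{R}^p.$$ (By lower semicontinuity these integrals are well defined in $(-\infty,\infty]$.) Let $\mathrm{vec}:\mathbb{R}^{n\times p}\to\mathbb{R}^{np}$ be the vectorization operator, which stacks the columns of a matrix. **Proposition.**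 If $f:\mathbb{R}^{n\times p}\to\mathbb{R}\cup\{\infty\}$ is matrix superharmonic, then $f\circ\mathrm{vec}^{-1}:\mathbb{R}^{np}\to\mathbb{R}\cup\{\infty\}$ is superharmonic. -/

import Mathlib

open MeasureTheory

noncomputable section

/-- The integral of an extended-real-valued function, `∫ f⁺ dμ - ∫ f⁻ dμ`. It is the usual
integral, with values in `(-∞, ∞]`, for every measurable `f` with `∫ f⁻ dμ < ∞`; on a finite
measure this covers every measurable `f` that is bounded below by a real number, in particular a
lower semicontinuous function with values in `(-∞, ∞]` on a compact space. -/
def extIntegral {α : Type*} [MeasurableSpace α] (μ : Measure α) (f : α → EReal) : EReal :=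
  ((∫⁻ a, (f a).toENNReal ∂μ : ENNReal) : EReal) - ((∫⁻ a, (-f a).toENNReal ∂μ : ENNReal) : EReal)

/-- The unit sphere `S_{0,1}` of `ℝ^d`. -/
abbrev UnitSphere (d : ℕ) : Type := Metric.sphere (0 : EuclideanSpace ℝ (Fin d)) 1

/-- The surface area measure on the unit sphere of `ℝ^d`. -/
def surfaceMeasure (d : ℕ) : Measure (UnitSphere d) :=
  (volume : Measure (EuclideanSpace ℝ (Fin d))).toSphere

/-- The surface area `Ω_d` of the unit sphere of `ℝ^d`. -/
def sphereArea (d : ℕ) : ENNReal := surfaceMeasure d Set.univ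

/-- The average of `f` over the sphere with center `x` and radius `r`. -/
def sphereAverage {d : ℕ} (f : EuclideanSpace ℝ (Fin d) → EReal)
    (x : EuclideanSpace ℝ (Fin d)) (r : ℝ) : EReal :=
  extIntegral (surfaceMeasure d)
    (fun e : UnitSphere d => f (x + r • (e : EuclideanSpace ℝ (Fin d)))) / (sphereArea d : EReal)

/-- Superharmonic functions `ℝ^d → ℝ ∪ {∞}`. -/
structure IsSuperharmonic {d : ℕ} (f : EuclideanSpace ℝ (Fin d) → EReal) : Prop where
  ne_bot : ∀ x, f x ≠ ⊥
  lowerSemicontinuous : LowerSemicontinuous f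
  exists_ne_top : ∃ x, f x ≠ ⊤
  sphereAverage_le : ∀ (x : EuclideanSpace ℝ (Fin d)) (r : ℝ), 0 < r → sphereAverage f x r ≤ f x

/-- The average of `f` over `{X + e ρᵀ | e ∈ ℝ^n, ‖e‖ = 1}`. -/
def matrixSphereAverage {n p : ℕ} (f : Matrix (Fin n) (Fin p) ℝ → EReal)
    (X : Matrix (Fin n) (Fin p) ℝ) (ρ : Fin p → ℝ) : EReal :=
  extIntegral (surfaceMeasure n)
    (fun e : UnitSphere n =>
      f (X + Matrix.vecMulVec (e : EuclideanSpace ℝ (Fin n)).ofLp ρ)) / (sphereArea n : EReal)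

/-- Matrix superharmonic functions `ℝ^{n × p} → ℝ ∪ {∞}`. -/
structure IsMatrixSuperharmonic {n p : ℕ} (f : Matrix (Fin n) (Fin p) ℝ → EReal) : Prop where
  ne_bot : ∀ X, f X ≠ ⊥
  lowerSemicontinuous : LowerSemicontinuous f
  exists_ne_top : ∃ X, f X ≠ ⊤
  matrixSphereAverage_le : ∀ (X : Matrix (Fin n) (Fin p) ℝ) (ρ : Fin p → ℝ),
    matrixSphereAverage f X ρ ≤ f X

/-- The position `i + n * j` of the entry in row `i` and column `j` when the columns of an
`n × p` matrix are stacked. -/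
def vecIndex (n p : ℕ) : Fin p × Fin n ≃ Fin (n * p) :=
  finProdFinEquiv.trans (finCongr (Nat.mul_comm p n))

/-- The vectorization (column stacking) `vec : ℝ^{n × p} → ℝ^{np}`. -/
def vecEquiv (n p : ℕ) : Matrix (Fin n) (Fin p) ℝ ≃ EuclideanSpace ℝ (Fin (n * p)) where
  toFun X := WithLp.toLp 2 (fun k => X.vec ((vecIndex n p).symm k))
  invFun v := Matrix.of (fun i j => v (vecIndex n p (j, i)))
  left_inv X := by
    ext i j
    simp [Matrix.vec]
  right_inv v := by
    ext k
    simp [Matrix.vec]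

end

/-! Taking `ρ` to be a multiple of a coordinate vector, matrix superharmonicity gives a spherical
mean value inequality in each column separately. A Gaussian is both radial and a product over the
columns. The column inequalities therefore multiply up to a Gaussian mean value inequality on the
whole space, localized to small balls (`lintegral_truncatedGaussian_mul_le_of_columns`).

To return to spheres, average the function over all rotations about the centre `c`. The result is
lower semicontinuous, keeps its value at `c`, is constant on spheres about `c`, and inherits the
Gaussian inequalities. A minimum principle (`le_apply_zero_of_gaussian_mean_le`) bounds its value at
`c` below by its constant value on the sphere of radius `r`, which is the spherical mean.

The Gaussian inequality compares a truncated mean with the full mass. The loss is a tail, negligible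
against the second moment when the Gaussian is concentrated (`exists_gaussianWeight_tail_lt`).
Adding a local lower bound `K` lets all of this run in `ENNReal` (`extIntegral_div_le_iff`). -/

/-! ### Averages over the orthogonal group and over spheres. -/

section Rotation

variable {E : Type*} [NormedAddCommGroup E] [InnerProductSpace ℝ E] [CompleteSpace E]

theorem norm_unitary_apply (R : unitary (E →L[ℝ] E)) (x : E) : ‖(R : E →L[ℝ] E) x‖ = ‖x‖ :=
  (Unitary.linearIsometryEquiv R).norm_map x

/-- The reflection in the hyperplane orthogonal to `x - y` exchanges two vectors of equal norm. -/
theorem exists_unitary_apply_eq {x y : E} (hxy : ‖x‖ = ‖y‖) :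
    ∃ R : unitary (E →L[ℝ] E), (R : E →L[ℝ] E) x = y :=
  ⟨Unitary.linearIsometryEquiv.symm (Submodule.reflection (ℝ ∙ (x - y))ᗮ), by
    simpa using Submodule.reflection_sub hxy⟩

theorem continuous_unitary_apply :
    Continuous fun q : unitary (E →L[ℝ] E) × E => (q.1 : E →L[ℝ] E) q.2 :=
  (continuous_subtype_val.comp continuous_fst).clm_apply continuous_snd

variable [FiniteDimensional ℝ E]

instance unitaryCompactSpace : CompactSpace (unitary (E →L[ℝ] E)) := by
  have : ProperSpace (E →L[ℝ] E) := FiniteDimensional.proper ℝ _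
  refine (isCompact_iff_compactSpace (s := (unitary (E →L[ℝ] E) : Set (E →L[ℝ] E)))).1 ?_
  refine Metric.isCompact_of_isClosed_isBounded ?_ ?_
  · exact isClosed_unitary
  · rw [isBounded_iff_forall_norm_le]
    refine ⟨1, fun R hR => ContinuousLinearMap.opNorm_le_bound _ zero_le_one fun x => ?_⟩
    simpa using (norm_unitary_apply ⟨R, hR⟩ x).le

instance unitarySecondCountable : SecondCountableTopology (unitary (E →L[ℝ] E)) := by
  have : ProperSpace (E →L[ℝ] E) := FiniteDimensional.proper ℝ _
  infer_instance

/-- A right-invariant probability measure on the orthogonal group of `E`. -/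
noncomputable def rotationMeasure (E : Type*) [NormedAddCommGroup E] [InnerProductSpace ℝ E]
    [FiniteDimensional ℝ E] [CompleteSpace E] : Measure (unitary (E →L[ℝ] E)) :=
  -- Inversion turns left invariance into right invariance, the side that absorbs `Q` in `R (Q x)`;
  -- unimodularity is not needed.
  (Measure.haarMeasure ⊤).inv

instance : (rotationMeasure E).IsMulRightInvariant := by
  unfold rotationMeasure; infer_instance

instance : IsProbabilityMeasure (rotationMeasure E) := by
  refine ⟨?_⟩
  rw [rotationMeasure, Measure.inv_apply]
  simpa using Measure.haarMeasure_self (K₀ := (⊤ : TopologicalSpace.PositiveCompacts (unitary (E →L[ℝ] E))))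

/-- The average of `h` over the rotations of `x`. -/
noncomputable def rotationAverage (h : E → ENNReal) (x : E) : ENNReal :=
  ∫⁻ R, h ((R : E →L[ℝ] E) x) ∂rotationMeasure E

theorem rotationAverage_eq_of_norm_eq (h : E → ENNReal) {x y : E} (hxy : ‖x‖ = ‖y‖) :
    rotationAverage h x = rotationAverage h y := by
  obtain ⟨Q, rfl⟩ := exists_unitary_apply_eq hxy
  exact (lintegral_mul_right_eq_self (μ := rotationMeasure E)
    (fun R => h ((R : E →L[ℝ] E) x)) Q).symm

theorem rotationAverage_zero (h : E → ENNReal) : rotationAverage h 0 = h 0 := by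
  simp [rotationAverage]

/-- Fatou's lemma applied to the rotated copies of `h`. -/
theorem lowerSemicontinuous_rotationAverage {h : E → ENNReal} (hh : LowerSemicontinuous h) :
    LowerSemicontinuous (rotationAverage h) := by
  borelize E
  refine lowerSemicontinuous_iff_le_liminf.2 fun x => ?_
  have h1 : ∀ R : unitary (E →L[ℝ] E), h ((R : E →L[ℝ] E) x)
      ≤ Filter.liminf (fun y => h ((R : E →L[ℝ] E) y)) (nhds x) := fun R =>
    lowerSemicontinuous_iff_le_liminf.1 (hh.comp (R : E →L[ℝ] E).continuous) x
  refine (lintegral_mono h1).trans (lintegral_liminf_le fun y => ?_)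
  exact hh.measurable.comp
    (continuous_unitary_apply.comp (continuous_id.prodMk continuous_const)).measurable

variable [MeasurableSpace E] [BorelSpace E]

/-- `toSphere` measures a set by the volume of the cone over it, and isometries preserve volume and
commute with forming cones. -/
theorem lintegral_toSphere_unitary (R : unitary (E →L[ℝ] E)) {h : E → ENNReal}
    (hh : Measurable h) :
    ∫⁻ e : Metric.sphere (0 : E) 1, h ((R : E →L[ℝ] E) e) ∂(volume : Measure E).toSphere
      = ∫⁻ e : Metric.sphere (0 : E) 1, h e ∂(volume : Measure E).toSphere := by
  set T : E ≃ₗᵢ[ℝ] E := Unitary.linearIsometryEquiv R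
  let τ : Metric.sphere (0 : E) 1 → Metric.sphere (0 : E) 1 := fun e => ⟨T e, by simp⟩
  have hτ : Measurable τ := by
    refine Measurable.subtype_mk ?_
    exact T.continuous.measurable.comp measurable_subtype_coe
  have key : (volume : Measure E).toSphere.map τ = (volume : Measure E).toSphere := by
    ext s hs
    rw [Measure.map_apply hτ hs, Measure.toSphere_apply' _ hs, Measure.toSphere_apply' _ (hτ hs)]
    congr 1
    symm
    rw [← T.measurePreserving.measure_preimage_emb T.toHomeomorph.measurableEmbedding]
    congr 1
    ext x
    simp only [Set.mem_smul, Set.mem_image, Set.mem_preimage, Set.mem_Ioo, ]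
    constructor
    · rintro ⟨r, hr, _, ⟨e, he, rfl⟩, hx⟩
      refine ⟨r, hr, _, ⟨⟨T.symm e, by simp⟩, ?_, rfl⟩, ?_⟩
      · simpa [τ] using he
      · apply T.injective
        simpa using hx
    · rintro ⟨r, hr, _, ⟨e, he, rfl⟩, rfl⟩
      exact ⟨r, hr, _, ⟨τ e, he, rfl⟩, by simp [τ]⟩
  conv_rhs => rw [← key]
  rw [lintegral_map (f := fun e : Metric.sphere (0 : E) 1 => h e)
    (hh.comp measurable_subtype_coe) hτ]
  rfl

theorem measurable_unitary_apply :
    Measurable fun q : unitary (E →L[ℝ] E) × E => (q.1 : E →L[ℝ] E) q.2 :=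
  continuous_unitary_apply.measurable

/-- Averaging over a sphere centred at the origin is averaging over rotations. -/
theorem lintegral_toSphere_eq_rotationAverage {h : E → ENNReal} (hh : Measurable h) {x : E} {s : ℝ}
    (hs : ‖x‖ = |s|) :
    ∫⁻ e : Metric.sphere (0 : E) 1, h (s • (e : E)) ∂(volume : Measure E).toSphere
      = (volume : Measure E).toSphere Set.univ * rotationAverage h x := by
  have h1 : ∀ R : unitary (E →L[ℝ] E),
      ∫⁻ e : Metric.sphere (0 : E) 1, h ((R : E →L[ℝ] E) (s • (e : E)))
        ∂(volume : Measure E).toSphere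
      = ∫⁻ e : Metric.sphere (0 : E) 1, h (s • (e : E)) ∂(volume : Measure E).toSphere := by
    intro R
    rw [← lintegral_toSphere_unitary R (h := fun e => h (s • e)) (hh.comp (measurable_const_smul s))]
    simp
  -- A rotation can be inserted for free; after Tonelli the inner integral no longer depends on `e`.
  calc _ = ∫⁻ R, ∫⁻ e : Metric.sphere (0 : E) 1, h ((R : E →L[ℝ] E) (s • (e : E)))
        ∂(volume : Measure E).toSphere ∂rotationMeasure E := by simp only [h1]; simp
    _ = ∫⁻ e : Metric.sphere (0 : E) 1, ∫⁻ R, h ((R : E →L[ℝ] E) (s • (e : E)))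
        ∂rotationMeasure E ∂(volume : Measure E).toSphere := by
      refine lintegral_lintegral_swap (Measurable.aemeasurable ?_)
      exact hh.comp (measurable_unitary_apply.comp (measurable_fst.prodMk
        ((measurable_subtype_coe.comp measurable_snd).const_smul s)))
    _ = ∫⁻ e : Metric.sphere (0 : E) 1, rotationAverage h x ∂(volume : Measure E).toSphere := by
      refine lintegral_congr fun e => ?_
      refine rotationAverage_eq_of_norm_eq h ?_
      rw [norm_smul, hs]; simp
    _ = _ := by rw [lintegral_const, mul_comm]

end Rotation

/-! ### A minimum principle for Gaussian means. -/

section MinimumPrinciple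

variable {E : Type*} [NormedAddCommGroup E] [InnerProductSpace ℝ E] [FiniteDimensional ℝ E]
  [MeasurableSpace E] [BorelSpace E]

/-- The unnormalized Gaussian weight `exp (-b ‖y‖²)`. -/
noncomputable def gaussianWeight (b : ℝ) (y : E) : ENNReal :=
  ENNReal.ofReal (Real.exp (-b * ‖y‖ ^ 2))

omit [InnerProductSpace ℝ E] [FiniteDimensional ℝ E] in
theorem measurable_gaussianWeight (b : ℝ) : Measurable (gaussianWeight b : E → ENNReal) := by
  unfold gaussianWeight
  fun_prop

theorem lintegral_gaussianWeight_lt_top {b : ℝ} (hb : 0 < b) :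
    ∫⁻ y : E, gaussianWeight b y < ⊤ := by
  have h := GaussianFourier.integrable_cexp_neg_mul_sq_norm_add (V := E) (b := (b : ℂ))
    (by simpa using hb) 0 0
  have h' : Integrable fun y : E => Real.exp (-b * ‖y‖ ^ 2) := by
    refine h.norm.congr (ae_of_all _ fun y => ?_)
    simp [Complex.norm_exp, ← Complex.ofReal_pow]
  exact h'.lintegral_lt_top

/-- As `b` grows, the tail is of order at most `exp (-b δ²)`, while points with `‖y‖ ≤ δ / 2`
already give the second moment order at least `exp (-b δ² / 4)`. -/
theorem exists_gaussianWeight_tail_lt [Nontrivial E] {δ : ℝ} (hδ : 0 < δ) {η : ℝ} (hη : 0 < η)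
    {a : ℝ} (ha : 0 ≤ a) :
    ∃ b : ℝ, 0 < b ∧
      ENNReal.ofReal a * ∫⁻ y in (Metric.ball (0 : E) δ)ᶜ, gaussianWeight b y
      < ENNReal.ofReal η *
        ∫⁻ y in Metric.ball (0 : E) δ, gaussianWeight b y * ENNReal.ofReal (‖y‖ ^ 2) := by
  -- The ball of radius `δ / 8` about a point of norm `3δ / 8` lies in the shell `δ / 4 ≤ ‖y‖ ≤ δ /
  -- 2`.
  obtain ⟨z, hz⟩ := exists_norm_eq E (c := 3 * δ / 8) (by positivity)
  set A := Metric.ball z (δ / 8) with hA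
  have hA1 : ∀ y ∈ A, δ / 4 ≤ ‖y‖ ∧ ‖y‖ ≤ δ / 2 := by
    intro y hy
    have h1 : ‖y - z‖ < δ / 8 := by simpa [A, dist_eq_norm] using hy
    have h2 := norm_sub_norm_le y z
    have h3 := norm_sub_norm_le z y
    rw [norm_sub_rev] at h3
    constructor <;> linarith
  have hAB : A ⊆ Metric.ball 0 δ := fun y hy => by
    simpa using (hA1 y hy).2.trans_lt (by linarith)
  set V := (volume A).toReal
  have hV : ENNReal.ofReal V = volume A := ENNReal.ofReal_toReal measure_ball_lt_top.ne
  have hV0 : 0 < V := ENNReal.toReal_pos (Metric.measure_ball_pos _ _ (by positivity)).ne'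
    measure_ball_lt_top.ne
  set M := (∫⁻ y : E, gaussianWeight 1 y).toReal
  have hM : ENNReal.ofReal M = ∫⁻ y : E, gaussianWeight 1 y :=
    ENNReal.ofReal_toReal (lintegral_gaussianWeight_lt_top one_pos).ne
  have hM0 : 0 ≤ M := ENNReal.toReal_nonneg
  set C := a * (Real.exp (δ ^ 2) * M)
  set D := η * (δ ^ 2 / 16 * V)
  have hC : 0 ≤ C := by positivity
  have hD : 0 < D := by positivity
  -- Chosen so that `b * (3δ² / 4) = 3δ² / 4 + C / D`, whence `exp t ≥ t + 1` beats `C / D`. The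
  -- summand `1` leaves a factor `gaussianWeight 1` to integrate over the tail.
  set b := 1 + C / D * (4 / (3 * δ ^ 2)) with hb
  have hb1 : 1 ≤ b := by
    have : 0 ≤ C / D * (4 / (3 * δ ^ 2)) := by positivity
    linarith
  have hkey : C * Real.exp (-b * δ ^ 2) < D * Real.exp (-b * (δ / 2) ^ 2) := by
    have h1 : C / D < Real.exp (b * (3 * δ ^ 2 / 4)) := by
      have := Real.add_one_le_exp (b * (3 * δ ^ 2 / 4))
      have h2 : b * (3 * δ ^ 2 / 4) = 3 * δ ^ 2 / 4 + C / D := by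
        rw [hb]; field_simp
      have h3 : 0 < 3 * δ ^ 2 / 4 := by positivity
      linarith
    have h2 : Real.exp (-b * (δ / 2) ^ 2) = Real.exp (b * (3 * δ ^ 2 / 4)) *
        Real.exp (-b * δ ^ 2) := by
      rw [← Real.exp_add]; congr 1; ring
    rw [h2, ← mul_assoc]
    refine mul_lt_mul_of_pos_right ?_ (Real.exp_pos _)
    rwa [div_lt_iff₀' hD] at h1
  refine ⟨b, by linarith, ?_⟩
  have hL : ∫⁻ y in (Metric.ball (0 : E) δ)ᶜ, gaussianWeight b y
      ≤ ENNReal.ofReal (Real.exp (-(b - 1) * δ ^ 2) * M) := by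
    rw [ENNReal.ofReal_mul (Real.exp_pos _).le, hM,
      ← lintegral_const_mul _ (measurable_gaussianWeight 1)]
    refine (setLIntegral_mono' (Metric.isOpen_ball.measurableSet.compl) fun y hy => ?_).trans
      (setLIntegral_le_lintegral _ _)
    have hy' : δ ≤ ‖y‖ := by simpa using hy
    rw [gaussianWeight, gaussianWeight, ← ENNReal.ofReal_mul (Real.exp_pos _).le, ← Real.exp_add]
    refine ENNReal.ofReal_le_ofReal (Real.exp_le_exp.2 ?_)
    have : δ ^ 2 ≤ ‖y‖ ^ 2 := by gcongr
    nlinarith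
  have hR : ENNReal.ofReal (Real.exp (-b * (δ / 2) ^ 2) * (δ ^ 2 / 16) * V) ≤
      ∫⁻ y in Metric.ball (0 : E) δ, gaussianWeight b y * ENNReal.ofReal (‖y‖ ^ 2) := by
    refine le_trans ?_ (lintegral_mono_set hAB)
    rw [ENNReal.ofReal_mul (by positivity), hV, ← setLIntegral_const]
    refine setLIntegral_mono' Metric.isOpen_ball.measurableSet fun y hy => ?_
    obtain ⟨h1, h2⟩ := hA1 y hy
    rw [ENNReal.ofReal_mul (by positivity), gaussianWeight]
    gcongr ENNReal.ofReal ?_ * ENNReal.ofReal ?_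
    · refine Real.exp_le_exp.2 ?_
      have : ‖y‖ ^ 2 ≤ (δ / 2) ^ 2 := by gcongr
      nlinarith
    · have : (δ / 4) ^ 2 ≤ ‖y‖ ^ 2 := by gcongr
      linarith
  refine (mul_le_mul_right hL _).trans_lt (lt_of_lt_of_le ?_ (mul_le_mul_right hR _))
  rw [← ENNReal.ofReal_mul ha, ← ENNReal.ofReal_mul hη.le]
  refine (ENNReal.ofReal_lt_ofReal_iff (by positivity)).2 ?_
  have e1 : Real.exp (-(b - 1) * δ ^ 2) = Real.exp (δ ^ 2) * Real.exp (-b * δ ^ 2) := by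
    rw [← Real.exp_add]; congr 1; ring
  rw [e1]
  simp only [C, D] at hkey
  linarith

/-- Minimum principle: a lower semicontinuous function which dominates its local Gaussian means at
the points of a ball is at the centre at least as large as its infimum over the boundary sphere. -/
theorem le_apply_zero_of_gaussian_mean_le [Nontrivial E] {F : E → ENNReal}
    (hF : LowerSemicontinuous F) {r : ℝ} (hr : 0 < r)
    (hmean : ∀ x, ‖x‖ < r → ∃ δ₀ > 0, ∀ δ, 0 < δ → δ < δ₀ → ∀ b > 0,
      ∫⁻ y in Metric.ball (0 : E) δ, gaussianWeight b y * F (x + y)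
        ≤ F x * ∫⁻ y : E, gaussianWeight b y)
    {M : ENNReal} (hM : ∀ x, ‖x‖ = r → M ≤ F x) : M ≤ F 0 := by
  by_contra! hlt
  obtain ⟨m, hm1, hm2⟩ := exists_between hlt
  have hm_top : m ≠ ⊤ := (hm2.trans_le le_top).ne
  have hF0 : F 0 ≠ ⊤ := (hm1.trans hm2 |>.trans_le le_top).ne
  -- With this `η` the perturbation `H` below has `H 0 = m`, while on the boundary sphere `H = F ≥ M
  -- > m`; so `H` attains its minimum inside.
  set η := (m - F 0).toReal / r ^ 2 with hη
  have hη0 : 0 < η := div_pos (ENNReal.toReal_pos (tsub_pos_of_lt hm1).ne'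
    (ENNReal.sub_ne_top hm_top)) (by positivity)
  have hηr : F 0 + ENNReal.ofReal (η * r ^ 2) = m := by
    rw [hη, div_mul_cancel₀ _ (by positivity), ENNReal.ofReal_toReal (ENNReal.sub_ne_top hm_top)]
    exact add_tsub_cancel_of_le hm1.le
  let H : E → ENNReal := fun x => F x + ENNReal.ofReal (η * (r ^ 2 - ‖x‖ ^ 2))
  have hH : LowerSemicontinuous H :=
    hF.add (ENNReal.continuous_ofReal.comp (by fun_prop)).lowerSemicontinuous
  obtain ⟨x₀, hx₀, hmin⟩ := (hH.lowerSemicontinuousOn _).exists_isMinOn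
    (Metric.nonempty_closedBall.2 hr.le) (isCompact_closedBall (0 : E) r)
  have hx₀r : ‖x₀‖ ≤ r := by simpa using hx₀
  have hH0 : H x₀ ≤ m := by
    refine (hmin (Metric.mem_closedBall_self hr.le)).trans ?_
    simp [H, hηr]
  have hx₀lt : ‖x₀‖ < r := by
    refine lt_of_le_of_ne hx₀r fun h => ?_
    have := (hM x₀ h).trans (le_self_add.trans hH0)
    exact absurd hm2 (not_lt.2 this)
  have hFx₀ : F x₀ ≠ ⊤ := ne_top_of_le_ne_top hm_top (le_self_add.trans hH0)
  obtain ⟨δ₀, hδ₀, hδ⟩ := hmean x₀ hx₀lt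
  set δ := min (δ₀ / 2) (r - ‖x₀‖) with hδdef
  have hδpos : 0 < δ := lt_min (by positivity) (by linarith)
  -- Pairing `y` with `-y` cancels the linear terms of the quadratic perturbation; the parallelogram
  -- law leaves exactly the gain `η ‖y‖²` on each side.
  have hsym : ∀ y ∈ Metric.ball (0 : E) δ,
      2 * F x₀ + 2 * ENNReal.ofReal (η * ‖y‖ ^ 2) ≤ F (x₀ + y) + F (x₀ - y) := by
    intro y hy
    have hy1 : ‖y‖ < r - ‖x₀‖ := by
      have : ‖y‖ < δ := by simpa using hy
      exact this.trans_le (min_le_right _ _)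
    have n1 : ‖x₀ + y‖ < r := (norm_add_le _ _).trans_lt (by linarith)
    have n2 : ‖x₀ - y‖ < r := (norm_sub_le _ _).trans_lt (by linarith)
    have a1 : H x₀ ≤ H (x₀ + y) := hmin (by simpa using n1.le)
    have a2 : H x₀ ≤ H (x₀ - y) := hmin (by simpa using n2.le)
    have hpar := parallelogram_law_with_norm ℝ x₀ y
    have q0 : 0 ≤ η * (r ^ 2 - ‖x₀‖ ^ 2) := by
      have : ‖x₀‖ ^ 2 ≤ r ^ 2 := by gcongr
      exact mul_nonneg hη0.le (by linarith)
    have q1 : 0 ≤ η * (r ^ 2 - ‖x₀ + y‖ ^ 2) := by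
      have : ‖x₀ + y‖ ^ 2 ≤ r ^ 2 := by gcongr
      exact mul_nonneg hη0.le (by linarith)
    have q2 : 0 ≤ η * (r ^ 2 - ‖x₀ - y‖ ^ 2) := by
      have : ‖x₀ - y‖ ^ 2 ≤ r ^ 2 := by gcongr
      exact mul_nonneg hη0.le (by linarith)
    have hs : ENNReal.ofReal (η * (r ^ 2 - ‖x₀ + y‖ ^ 2))
        + ENNReal.ofReal (η * (r ^ 2 - ‖x₀ - y‖ ^ 2)) + 2 * ENNReal.ofReal (η * ‖y‖ ^ 2)
        = 2 * ENNReal.ofReal (η * (r ^ 2 - ‖x₀‖ ^ 2)) := by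
      have q3 : 0 ≤ η * ‖y‖ ^ 2 := by positivity
      rw [two_mul, two_mul, ← ENNReal.ofReal_add q1 q2, ← ENNReal.ofReal_add q3 q3,
        ← ENNReal.ofReal_add q0 q0, ← ENNReal.ofReal_add (add_nonneg q1 q2) (add_nonneg q3 q3)]
      congr 1
      linear_combination (-η) * hpar
    have a3 := add_le_add a1 a2
    simp only [H] at a3
    set s := ENNReal.ofReal (η * (r ^ 2 - ‖x₀ + y‖ ^ 2))
      + ENNReal.ofReal (η * (r ^ 2 - ‖x₀ - y‖ ^ 2)) with hsdef
    have hs_top : s ≠ ⊤ := by simp [s]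
    refine (ENNReal.add_le_add_iff_right hs_top).1 ?_
    calc 2 * F x₀ + 2 * ENNReal.ofReal (η * ‖y‖ ^ 2) + s
        = 2 * F x₀ + (s + 2 * ENNReal.ofReal (η * ‖y‖ ^ 2)) := by ring
      _ = (F x₀ + ENNReal.ofReal (η * (r ^ 2 - ‖x₀‖ ^ 2))) +
          (F x₀ + ENNReal.ofReal (η * (r ^ 2 - ‖x₀‖ ^ 2))) := by rw [hs]; ring
      _ ≤ _ := a3
      _ = _ := by rw [hsdef]; ring
  obtain ⟨b, hb, hlt'⟩ := exists_gaussianWeight_tail_lt (E := E) hδpos hη0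
    (a := (F x₀).toReal) ENNReal.toReal_nonneg
  rw [ENNReal.ofReal_toReal hFx₀] at hlt'
  -- Integrating `hsym` against the Gaussian and using the mean inequality at `x₀` makes the second
  -- moment gain at most `F x₀` times the tail, contrary to the choice of `b`.
  refine absurd hlt' (not_lt.2 ?_)
  set W : E → ENNReal := gaussianWeight b
  have hW : Measurable W := measurable_gaussianWeight b
  have hFm : Measurable F := hF.measurable
  set B := Metric.ball (0 : E) δ
  have hB : MeasurableSet B := Metric.isOpen_ball.measurableSet
  have h1 := hδ δ hδpos ((min_le_left _ _).trans_lt (by linarith)) b hb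
  have h2 : ∫⁻ y in B, W y * F (x₀ - y) = ∫⁻ y in B, W y * F (x₀ + y) := by
    rw [← lintegral_indicator hB, ← lintegral_indicator hB,
      ← lintegral_neg_eq_self]
    refine lintegral_congr fun y => ?_
    simp [Set.indicator, B, W, gaussianWeight]
  have htop : F x₀ * ∫⁻ y in B, W y ≠ ⊤ := ENNReal.mul_ne_top hFx₀
    ((setLIntegral_le_lintegral _ _).trans_lt (lintegral_gaussianWeight_lt_top hb)).ne
  have h3 : 2 * (F x₀ * (∫⁻ y in B, W y) +
      ENNReal.ofReal η * ∫⁻ y in B, W y * ENNReal.ofReal (‖y‖ ^ 2))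
      ≤ 2 * (F x₀ * ((∫⁻ y in B, W y) + ∫⁻ y in Bᶜ, W y)) := by
    calc _ = ∫⁻ y in B, W y * (2 * F x₀ + 2 * ENNReal.ofReal (η * ‖y‖ ^ 2)) := by
          rw [← lintegral_const_mul _ hW, ← lintegral_const_mul _ (by fun_prop),
            ← lintegral_add_left (by fun_prop), ← lintegral_const_mul _ (by fun_prop)]
          refine lintegral_congr fun y => ?_
          rw [ENNReal.ofReal_mul hη0.le]
          ring
      _ ≤ ∫⁻ y in B, W y * (F (x₀ + y) + F (x₀ - y)) :=
          setLIntegral_mono' hB fun y hy => mul_le_mul_right (hsym y hy) _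
      _ = 2 * ∫⁻ y in B, W y * F (x₀ + y) := by
          simp_rw [mul_add]
          rw [lintegral_add_left (by fun_prop), h2, two_mul]
      _ ≤ _ := by
          rw [lintegral_add_compl _ hB]
          gcongr
  have h4 := (ENNReal.mul_le_mul_iff_right two_ne_zero ENNReal.ofNat_ne_top).1 h3
  rw [mul_add] at h4
  exact (ENNReal.add_le_add_iff_left htop).1 h4

end MinimumPrinciple

/-! ### From column means to Gaussian means to spherical means. -/

section GaussianMeans

/-- The Gaussian weight `exp (-b ‖y‖²)` restricted to the ball of radius `δ`. -/
noncomputable def truncatedGaussian {E : Type*} [NormedAddCommGroup E] (b δ : ℝ) : E → ENNReal :=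
  (Metric.ball (0 : E) δ).indicator (gaussianWeight b)

theorem measurable_truncatedGaussian {E : Type*} [NormedAddCommGroup E] [MeasurableSpace E]
    [BorelSpace E] (b δ : ℝ) : Measurable (truncatedGaussian b δ : E → ENNReal) :=
  (measurable_gaussianWeight b).indicator Metric.isOpen_ball.measurableSet

theorem setLIntegral_ball_gaussianWeight {E : Type*} [NormedAddCommGroup E] [MeasurableSpace E]
    [BorelSpace E] (μ : Measure E) (b δ : ℝ) (g : E → ENNReal) :
    ∫⁻ y in Metric.ball (0 : E) δ, gaussianWeight b y * g y ∂μ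
      = ∫⁻ y, truncatedGaussian b δ y * g y ∂μ := by
  rw [← lintegral_indicator Metric.isOpen_ball.measurableSet]
  simp only [truncatedGaussian, Set.indicator_mul_left]

section Isotropy

variable {E : Type*} [NormedAddCommGroup E] [InnerProductSpace ℝ E] [FiniteDimensional ℝ E]
  [CompleteSpace E] [MeasurableSpace E] [BorelSpace E]

theorem lintegral_truncatedGaussian_mul_unitary (b δ : ℝ) (R : unitary (E →L[ℝ] E))
    (g : E → ENNReal) :
    ∫⁻ y, truncatedGaussian b δ y * g ((R : E →L[ℝ] E) y)
      = ∫⁻ y, truncatedGaussian b δ y * g y := by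
  set T : E ≃ₗᵢ[ℝ] E := Unitary.linearIsometryEquiv R
  conv_rhs =>
    rw [← T.measurePreserving.lintegral_comp_emb T.toHomeomorph.measurableEmbedding]
  refine lintegral_congr fun y => ?_
  have h : truncatedGaussian b δ (T y) = truncatedGaussian b δ y := by
    simp only [truncatedGaussian, Set.indicator, gaussianWeight, mem_ball_zero_iff, T.norm_map]
  rw [h]
  rfl

theorem lintegral_truncatedGaussian_mul_rotationAverage (b δ : ℝ) {g : E → ENNReal}
    (hg : Measurable g) :
    ∫⁻ y, truncatedGaussian b δ y * rotationAverage g y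
      = ∫⁻ y, truncatedGaussian b δ y * g y := by
  have hm : Measurable fun q : unitary (E →L[ℝ] E) × E => g ((q.1 : E →L[ℝ] E) q.2) :=
    hg.comp measurable_unitary_apply
  have hm' : ∀ y, Measurable fun R : unitary (E →L[ℝ] E) => g ((R : E →L[ℝ] E) y) := fun y =>
    hm.comp measurable_prodMk_right
  calc _ = ∫⁻ y, ∫⁻ R : unitary (E →L[ℝ] E), truncatedGaussian b δ y * g ((R : E →L[ℝ] E) y)
        ∂rotationMeasure E := by
        refine lintegral_congr fun y => ?_
        rw [rotationAverage, lintegral_const_mul _ (hm' y)]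
    _ = ∫⁻ R : unitary (E →L[ℝ] E), (∫⁻ y, truncatedGaussian b δ y * g ((R : E →L[ℝ] E) y))
        ∂rotationMeasure E := by
        refine (lintegral_lintegral_swap (Measurable.aemeasurable ?_)).symm
        exact ((measurable_truncatedGaussian b δ).comp measurable_snd).mul hm
    _ = _ := by
        simp only [lintegral_truncatedGaussian_mul_unitary]
        simp

/-- The weight is radial, so `g` may be replaced by its rotation average, which is controlled
wherever the weight is nonzero. -/
theorem lintegral_truncatedGaussian_mul_le {b δ : ℝ} {g : E → ENNReal} (hg : Measurable g)
    {C : ENNReal} (hC : ∀ y, ‖y‖ < δ → rotationAverage g y ≤ C) :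
    ∫⁻ y, truncatedGaussian b δ y * g y ≤ (∫⁻ y : E, gaussianWeight b y) * C := by
  rw [← lintegral_truncatedGaussian_mul_rotationAverage b δ hg,
    ← lintegral_mul_const _ (measurable_gaussianWeight b)]
  refine lintegral_mono fun y => ?_
  by_cases hy : ‖y‖ < δ
  · simpa [truncatedGaussian, Set.indicator, hy] using mul_le_mul_right (hC y hy) _
  · simp [truncatedGaussian, Set.indicator, hy]

end Isotropy

section Product

variable {ι A : Type*} [Fintype ι] [DecidableEq ι] [MeasurableSpace A] (μ : Measure A)
  [SigmaFinite μ]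

omit [Fintype ι] in
-- Splits off one coordinate of the weighted integral, for induction on the set of integrated
-- coordinates.
theorem lmarginal_prod_insert {w : A → ENNReal} (hw : Measurable w) {g : (ι → A) → ENNReal}
    (hg : Measurable g) {i : ι} {s : Finset ι} (hi : i ∉ s) (z : ι → A) :
    (∫⋯∫⁻_insert i s, fun y => (∏ j ∈ insert i s, w (y j)) * g y ∂fun _ => μ) z
      = ∫⁻ a, w a * (∫⋯∫⁻_s, fun y => (∏ j ∈ s, w (y j)) * g y ∂fun _ => μ)
          (Function.update z i a) ∂μ := by
  have hm : ∀ s : Finset ι, Measurable fun y : ι → A => (∏ j ∈ s, w (y j)) * g y := fun s => by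
    fun_prop
  rw [lmarginal_insert _ (hm _) hi]
  refine lintegral_congr fun a => ?_
  rw [lmarginal, lmarginal, ← lintegral_const_mul (w a) (f := fun y : s → A =>
    (∏ j ∈ s, w (Function.updateFinset (Function.update z i a) s y j)) *
      g (Function.updateFinset (Function.update z i a) s y))
    ((hm s).comp measurable_updateFinset)]
  refine lintegral_congr fun y => ?_
  rw [Finset.prod_insert hi, mul_assoc]
  simp [Function.updateFinset, hi]

omit [Fintype ι] in
theorem lmarginal_prod {w : A → ENNReal} (hw : Measurable w) (s : Finset ι) (z : ι → A) :
    (∫⋯∫⁻_s, fun y => (∏ j ∈ s, w (y j)) * 1 ∂fun _ => μ) z = (∫⁻ a, w a ∂μ) ^ s.card := by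
  induction s using Finset.induction_on generalizing z with
  | empty => simp
  | insert i s hi ih =>
    rw [lmarginal_prod_insert μ hw measurable_const hi]
    simp only [ih]
    rw [lintegral_mul_const _ hw, Finset.card_insert_of_notMem hi, pow_succ']

theorem lintegral_pi_prod {w : A → ENNReal} (hw : Measurable w) [Nonempty A] :
    ∫⁻ y : ι → A, ∏ j, w (y j) ∂Measure.pi (fun _ => μ) = (∫⁻ a, w a ∂μ) ^ Fintype.card ι := by
  rw [lintegral_eq_lmarginal_univ (fun _ => Classical.arbitrary A)]
  simpa using lmarginal_prod μ hw (Finset.univ : Finset ι) (fun _ => Classical.arbitrary A)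

omit [Fintype ι] in
/-- Iterating a mean value inequality in every coordinate gives one for the product weight. -/
theorem lmarginal_prod_mul_le {w : A → ENNReal} (hw : Measurable w) {g : (ι → A) → ENNReal}
    (hg : Measurable g) (o : A) {S : Set A} (hS : ∀ a ∉ S, w a = 0) (hoS : o ∈ S) {Z : ENNReal}
    (hcol : ∀ (z : ι → A) (i : ι), (∀ j, z j ∈ S) → z i = o →
      ∫⁻ a, w a * g (Function.update z i a) ∂μ ≤ Z * g z) (s : Finset ι) (z : ι → A)
    (hz : ∀ j ∉ s, z j ∈ S) :
    (∫⋯∫⁻_s, fun y => (∏ j ∈ s, w (y j)) * g y ∂fun _ => μ) z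
      ≤ Z ^ s.card * g (fun j => if j ∈ s then o else z j) := by
  -- Each integration resets one coordinate to `o`. The induction hypothesis is needed only for `a ∈
  -- S`, as `w` vanishes elsewhere, so the frozen coordinates remain admissible for `hcol`.
  induction s using Finset.induction_on generalizing z with
  | empty => simp
  | insert i s hi ih =>
    rw [lmarginal_prod_insert μ hw hg hi]
    set z' : ι → A := fun j => if j ∈ insert i s then o else z j with hz'
    have hz'S : ∀ j, z' j ∈ S := fun j => by
      by_cases hj : j ∈ insert i s
      · simpa only [z', hj, if_true] using hoS
      · simpa only [z', hj, if_false] using hz j hj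
    calc _ ≤ ∫⁻ a, Z ^ s.card * (w a * g (Function.update z' i a)) ∂μ := by
          refine lintegral_mono fun a => ?_
          by_cases ha : a ∈ S
          · have h := ih (Function.update z i a) fun j hj => by
              by_cases hji : j = i
              · subst hji; simpa using ha
              · simpa [hji] using hz j (by simp [hji, hj])
            have e : (fun j => if j ∈ s then o else Function.update z i a j)
                = Function.update z' i a := by
              ext j
              by_cases hji : j = i
              · subst hji; simp [hi]
              · simp [z', hji]
            rw [e] at h
            calc _ ≤ w a * (Z ^ s.card * g (Function.update z' i a)) := mul_le_mul_right h _
              _ = _ := by ring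
          · simp [hS a ha]
      _ = Z ^ s.card * ∫⁻ a, w a * g (Function.update z' i a) ∂μ :=
          lintegral_const_mul _ (hw.mul (hg.comp (measurable_update z')))
      _ ≤ Z ^ s.card * (Z * g z') := mul_le_mul_right (hcol z' i hz'S (by simp [z'])) _
      _ = _ := by rw [Finset.card_insert_of_notMem hi, pow_succ, mul_assoc]

theorem lintegral_pi_prod_mul_le {w : A → ENNReal} (hw : Measurable w) {g : (ι → A) → ENNReal}
    (hg : Measurable g) (o : A) {S : Set A} (hS : ∀ a ∉ S, w a = 0) (hoS : o ∈ S) {Z : ENNReal}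
    (hcol : ∀ (z : ι → A) (i : ι), (∀ j, z j ∈ S) → z i = o →
      ∫⁻ a, w a * g (Function.update z i a) ∂μ ≤ Z * g z) :
    ∫⁻ y, (∏ j, w (y j)) * g y ∂Measure.pi (fun _ => μ) ≤ Z ^ Fintype.card ι * g (fun _ => o) := by
  rw [lintegral_eq_lmarginal_univ (fun _ => o)]
  simpa using lmarginal_prod_mul_le μ hw hg o hS hoS hcol Finset.univ (fun _ => o) (by simp)

end Product

section Columns

variable {ι A E : Type*} [Fintype ι] [DecidableEq ι]
  [NormedAddCommGroup A] [InnerProductSpace ℝ A] [FiniteDimensional ℝ A]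
  [CompleteSpace A] [MeasurableSpace A] [BorelSpace A]
  [NormedAddCommGroup E] [InnerProductSpace ℝ E] [FiniteDimensional ℝ E]
  [CompleteSpace E] [MeasurableSpace E] [BorelSpace E]

omit [DecidableEq ι] [FiniteDimensional ℝ A] [CompleteSpace A] [MeasurableSpace A] [BorelSpace A]
  [FiniteDimensional ℝ E] [CompleteSpace E] [MeasurableSpace E] [BorelSpace E] in
theorem norm_le_card_mul_of_norm_sq_eq_sum (L : (ι → A) ≃L[ℝ] E)
    (hL : ∀ v, ‖L v‖ ^ 2 = ∑ j, ‖v j‖ ^ 2) {v : ι → A} {δ : ℝ} (hv : ∀ j, ‖v j‖ ≤ δ) :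
    ‖L v‖ ≤ Fintype.card ι * δ := by
  have h1 : ‖L v‖ ≤ ∑ j, ‖v j‖ := by
    refine le_of_sq_le_sq ?_ (by positivity)
    rw [hL]
    exact Finset.sum_sq_le_sq_sum_of_nonneg fun j _ => norm_nonneg _
  refine h1.trans ((Finset.sum_le_sum fun j _ => hv j).trans ?_)
  simp

omit [CompleteSpace E] in
/-- Mean value inequalities over small spheres in every column imply one for the truncated
Gaussian on the whole space. -/
theorem lintegral_truncatedGaussian_mul_le_of_columns (L : (ι → A) ≃L[ℝ] E)
    (hL : ∀ v, ‖L v‖ ^ 2 = ∑ j, ‖v j‖ ^ 2) {u : E → ENNReal} (hu : Measurable u) (x : E)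
    {δ : ℝ} (hδ : 0 < δ)
    (hcol : ∀ (v : ι → A) (j : ι) (a : A), (∀ j, ‖v j‖ < δ) → ‖a‖ < δ →
      rotationAverage (fun a => u (x + L v + L (Pi.single j a))) a ≤ u (x + L v)) (b : ℝ) :
    ∫⁻ y, truncatedGaussian b δ y * u (x + y) ≤ (∫⁻ y : E, gaussianWeight b y) * u x := by
  set m : Measure E := Measure.map L volume
  -- By uniqueness of Haar measure `L` scales volume by a constant; its value is irrelevant, since
  -- it cancels from both sides.
  obtain ⟨c, hc⟩ : ∃ c : NNReal, m = c • (volume : Measure E) :=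
    ⟨_, Measure.isAddLeftInvariant_eq_smul m volume⟩
  have hLm : Measurable L := L.continuous.measurable
  have hc0 : (c : ENNReal) ≠ 0 := by
    intro h
    have h' : c = 0 := by exact_mod_cast h
    have : m ≠ 0 := NeZero.ne m
    exact this (by rw [hc, h', zero_smul])
  have hint : ∀ h : E → ENNReal, Measurable h →
      c * ∫⁻ y, h y = ∫⁻ v : ι → A, h (L v) := by
    intro h hh
    rw [← lintegral_map hh hLm]
    change _ = ∫⁻ y, h y ∂m
    rw [hc, lintegral_smul_measure]
    rfl
  have hprod : ∀ v : ι → A, gaussianWeight b (L v) = ∏ j, gaussianWeight b (v j) := by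
    intro v
    simp only [gaussianWeight]
    rw [← ENNReal.ofReal_prod_of_nonneg (fun j _ => (Real.exp_pos _).le), ← Real.exp_sum, hL,
      Finset.mul_sum]
  -- The `δ`-ball of `E` lies in the product of the column balls, and the Gaussian factors by `hL`.
  have hle : ∀ v : ι → A, truncatedGaussian b δ (L v) ≤ ∏ j, truncatedGaussian b δ (v j) := by
    intro v
    by_cases hv : ‖L v‖ < δ
    · have hj : ∀ j, ‖v j‖ < δ := fun j => by
        refine lt_of_le_of_lt ?_ hv
        refine le_of_sq_le_sq ?_ (norm_nonneg _)
        rw [hL]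
        exact Finset.single_le_sum (f := fun j => ‖v j‖ ^ 2) (fun j _ => by positivity)
          (Finset.mem_univ j)
      simp [truncatedGaussian, Set.indicator, hv, hj, hprod]
    · simp [truncatedGaussian, Set.indicator, hv]
  refine (ENNReal.mul_le_mul_iff_right hc0 ENNReal.coe_ne_top).1 ?_
  have hug : Measurable fun v : ι → A => u (x + L v) := by fun_prop
  rw [hint _ (by have := measurable_truncatedGaussian (E := E) b δ; fun_prop), ← mul_assoc,
    hint _ (measurable_gaussianWeight b)]
  calc _ ≤ ∫⁻ v : ι → A, (∏ j, truncatedGaussian b δ (v j)) * u (x + L v) :=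
        lintegral_mono fun v => mul_le_mul_left (hle v) _
    _ ≤ (∫⁻ a : A, gaussianWeight b a) ^ Fintype.card ι * u (x + L (fun _ => 0)) := by
        refine lintegral_pi_prod_mul_le volume (measurable_truncatedGaussian b δ) hug 0
          (S := Metric.ball 0 δ) (fun a ha => by simp [truncatedGaussian, ha]) (by simpa using hδ) ?_
        intro z i hz hzi
        refine lintegral_truncatedGaussian_mul_le
          (hug.comp (measurable_update z)) fun a ha => ?_
        have h := hcol z i a (fun j => by simpa using hz j) ha
        refine le_of_eq_of_le ?_ h
        congr 1
        ext a
        rw [Function.comp_apply, add_assoc, ← map_add]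
        congr 3
        ext1 j
        by_cases hj : j = i
        · subst hj; simp [hzi]
        · simp [hj]
    _ = _ := by
        have : L (fun _ => 0) = 0 := L.map_zero
        rw [this, add_zero]
        congr 1
        simp only [hprod]
        exact (lintegral_pi_prod volume (measurable_gaussianWeight b)).symm

/-- Mean value inequalities over spheres in every column imply the mean value inequality over
spheres in the whole space. -/
theorem rotationAverage_le_of_columns [Nontrivial E] (L : (ι → A) ≃L[ℝ] E)
    (hL : ∀ v, ‖L v‖ ^ 2 = ∑ j, ‖v j‖ ^ 2) {u : E → ENNReal} (hu : LowerSemicontinuous u) (c : E)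
    {r R : ℝ} (hr : 0 < r) (hrR : r < R)
    (hcol : ∀ (v : ι → A) (j : ι) (a : A), ‖L v - c‖ + ‖a‖ < R →
      rotationAverage (fun a => u (L v + L (Pi.single j a))) a ≤ u (L v))
    {x : E} (hx : ‖x‖ = r) : rotationAverage (fun y => u (c + y)) x ≤ u c := by
  have huc : LowerSemicontinuous fun y => u (c + y) := hu.comp (continuous_const.add continuous_id)
  have hum : Measurable u := hu.measurable
  -- The rotation average is constant on the sphere of radius `r`, so its boundary infimum is its
  -- value at `x`.
  have key := le_apply_zero_of_gaussian_mean_le (lowerSemicontinuous_rotationAverage huc) hr ?_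
    (M := rotationAverage (fun y => u (c + y)) x)
    fun y hy => (rotationAverage_eq_of_norm_eq _ (hx.trans hy.symm)).le
  · simpa [rotationAverage_zero] using key
  intro x hx
  -- Room for `‖L v‖ ≤ card ι * δ` plus one column sphere of radius below `δ`, so that `hcol`
  -- applies within distance `R` of `c`.
  refine ⟨(R - r) / (Fintype.card ι + 1), div_pos (by linarith) (by positivity), ?_⟩
  intro δ hδ hδ' b hb
  rw [lt_div_iff₀ (by positivity)] at hδ'
  have hQ : ∀ Q : unitary (E →L[ℝ] E),
      ∫⁻ y, truncatedGaussian b δ y * u (c + (Q : E →L[ℝ] E) x + y)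
        ≤ (∫⁻ y : E, gaussianWeight b y) * u (c + (Q : E →L[ℝ] E) x) := by
    intro Q
    refine lintegral_truncatedGaussian_mul_le_of_columns L hL hum _ hδ ?_ b
    intro v j a hv ha
    set v' := L.symm (c + (Q : E →L[ℝ] E) x + L v) with hv'
    have e : L v' = c + (Q : E →L[ℝ] E) x + L v := by simp [v']
    rw [← e]
    refine hcol v' j a ?_
    rw [e]
    have h1 := norm_le_card_mul_of_norm_sq_eq_sum L hL fun j => (hv j).le
    have h2 : ‖c + (Q : E →L[ℝ] E) x + L v - c‖ ≤ ‖x‖ + ‖L v‖ := by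
      rw [show c + (Q : E →L[ℝ] E) x + L v - c = (Q : E →L[ℝ] E) x + L v by abel]
      exact (norm_add_le _ _).trans (by rw [norm_unitary_apply])
    nlinarith
  have hm : Measurable fun q : unitary (E →L[ℝ] E) × E => u (c + (q.1 : E →L[ℝ] E) (x + q.2)) :=
    hum.comp (measurable_const.add (measurable_unitary_apply.comp
      (measurable_fst.prodMk (measurable_const.add measurable_snd))))
  have hm' : ∀ y, Measurable fun Q : unitary (E →L[ℝ] E) => u (c + (Q : E →L[ℝ] E) (x + y)) :=
    fun y => hm.comp measurable_prodMk_right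
  have hm0 : Measurable fun Q : unitary (E →L[ℝ] E) => u (c + (Q : E →L[ℝ] E) x) := by
    simpa only [add_zero] using hm' 0
  rw [setLIntegral_ball_gaussianWeight]
  calc _ = ∫⁻ y, ∫⁻ Q : unitary (E →L[ℝ] E),
          truncatedGaussian b δ y * u (c + (Q : E →L[ℝ] E) (x + y)) ∂rotationMeasure E := by
        refine lintegral_congr fun y => ?_
        rw [rotationAverage, lintegral_const_mul _ (hm' y)]
    _ = ∫⁻ Q : unitary (E →L[ℝ] E), (∫⁻ y,
          truncatedGaussian b δ y * u (c + (Q : E →L[ℝ] E) (x + y))) ∂rotationMeasure E := by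
        refine (lintegral_lintegral_swap (Measurable.aemeasurable ?_)).symm
        exact ((measurable_truncatedGaussian b δ).comp measurable_snd).mul hm
    _ = ∫⁻ Q : unitary (E →L[ℝ] E), (∫⁻ y,
          truncatedGaussian b δ y * u (c + (Q : E →L[ℝ] E) x + y)) ∂rotationMeasure E := by
        refine lintegral_congr fun Q => ?_
        -- Rotating the increment along with the centre does not change the weight.
        rw [← lintegral_truncatedGaussian_mul_unitary b δ Q
          fun y => u (c + (Q : E →L[ℝ] E) x + y)]
        simp only [map_add, add_assoc]
    _ ≤ ∫⁻ Q : unitary (E →L[ℝ] E), (∫⁻ y : E, gaussianWeight b y) * u (c + (Q : E →L[ℝ] E) x)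
          ∂rotationMeasure E := lintegral_mono hQ
    _ = _ := by rw [lintegral_const_mul _ hm0, mul_comm]; rfl

end Columns

end GaussianMeans

/-! ### Extended-real integrals, vectorization and the conclusion. -/

/-- Integrate the identity `(x + K)⁺ + x⁻ = x⁺ + K`, valid for `x ≥ -K`. The negative part is at
most `K`, so its integral is finite and can be cancelled. -/
theorem extIntegral_div_le_iff {α : Type*} [MeasurableSpace α] {μ : Measure α} [IsFiniteMeasure μ]
    (hμ : μ Set.univ ≠ 0) {g : α → EReal} (hg : Measurable g) {K : NNReal}
    (hgK : ∀ a, -((K : ℝ) : EReal) ≤ g a) {c : EReal} (hc : -((K : ℝ) : EReal) ≤ c) :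
    extIntegral μ g / (μ Set.univ : EReal) ≤ c ↔
      ∫⁻ a, (g a + ((K : ℝ) : EReal)).toENNReal ∂μ
        ≤ μ Set.univ * (c + ((K : ℝ) : EReal)).toENNReal := by
  have hpt : ∀ x : EReal, -((K : ℝ) : EReal) ≤ x →
      (x + ((K : ℝ) : EReal)).toENNReal + (-x).toENNReal = x.toENNReal + K := by
    intro x hx
    induction x using EReal.rec with
    | bot => simp at hx
    | top => simp
    | coe x =>
      have hx' : -(K : ℝ) ≤ x := by exact_mod_cast hx
      rw [← EReal.coe_add, ← EReal.coe_neg, EReal.real_coe_toENNReal, EReal.real_coe_toENNReal,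
        EReal.real_coe_toENNReal, ← ENNReal.ofReal_coe_nnreal]
      rcases le_total 0 x with h | h
      · rw [ENNReal.ofReal_of_nonpos (p := -x) (by linarith), add_zero,
          ENNReal.ofReal_add h K.coe_nonneg]
      · rw [ENNReal.ofReal_of_nonpos h, zero_add, ← ENNReal.ofReal_add (by linarith) (by linarith)]
        congr 1; ring
  have hneg : ∀ a, (-g a).toENNReal ≤ K := fun a => by
    have h : (-g a).toENNReal ≤ (((K : ℝ) : EReal)).toENNReal :=
      EReal.toENNReal_le_toENNReal (EReal.neg_le_of_neg_le (hgK a))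
    simpa using h
  have hN : ∫⁻ a, (-g a).toENNReal ∂μ ≠ ⊤ := by
    refine ne_top_of_le_ne_top ?_ (lintegral_mono hneg)
    rw [lintegral_const]
    exact ENNReal.mul_ne_top ENNReal.coe_ne_top (measure_ne_top _ _)
  have hsum : (∫⁻ a, (g a + ((K : ℝ) : EReal)).toENNReal ∂μ) + ∫⁻ a, (-g a).toENNReal ∂μ
      = (∫⁻ a, (g a).toENNReal ∂μ) + K * μ Set.univ := by
    rw [← lintegral_const, ← lintegral_add_right _ (g := fun a => (-g a).toENNReal) hg.neg.ereal_toENNReal,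
      ← lintegral_add_right _ measurable_const]
    exact lintegral_congr fun a => hpt _ (hgK a)
  rw [extIntegral]
  generalize (∫⁻ a, (g a + ((K : ℝ) : EReal)).toENNReal ∂μ) = I at *
  generalize (∫⁻ a, (g a).toENNReal ∂μ) = P at *
  generalize (∫⁻ a, (-g a).toENNReal ∂μ) = N at *
  have hΩ := measure_ne_top μ Set.univ
  generalize μ Set.univ = Ω at *
  lift N to NNReal using hN
  lift Ω to NNReal using hΩ
  have hΩ0 : 0 < (Ω : ℝ) := by
    have : Ω ≠ 0 := by exact_mod_cast hμ
    positivity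
  rw [EReal.div_le_iff_le_mul (by exact_mod_cast hΩ0) (by simp)]
  induction c using EReal.rec with
  | bot => simp at hc
  | top =>
    have h1 : ((Ω : ENNReal) : EReal) * ⊤ = ⊤ :=
      EReal.mul_top_of_pos (by exact_mod_cast hΩ0)
    simp [h1, hμ, ENNReal.mul_top]
  | coe c =>
    have hc' : 0 ≤ c + K := by
      have : -(K : ℝ) ≤ c := by exact_mod_cast hc
      linarith
    rw [← EReal.coe_add, EReal.real_coe_toENNReal]
    -- If the positive part has infinite integral, both inequalities fail for real `c`.
    by_cases hP : P = ⊤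
    · subst hP
      have hI : I = ⊤ := by simpa using hsum
      subst hI
      have h2 : ENNReal.ofReal (c + K) * Ω ≠ ⊤ :=
        ENNReal.mul_ne_top ENNReal.ofReal_ne_top ENNReal.coe_ne_top
      constructor
      · intro h
        exfalso
        have h3 : ((⊤ : ENNReal) : EReal) - ((N : ENNReal) : EReal) = ⊤ := by
          simp
        rw [h3, top_le_iff] at h
        have h4 : ((Ω : ENNReal) : EReal) * (c : EReal) = (((Ω : ℝ) * c : ℝ) : EReal) := by
          push_cast; rfl
        rw [h4] at h
        exact EReal.coe_ne_top _ h
      · intro h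
        rw [top_le_iff, mul_comm] at h
        exact absurd h h2
    · have hI : I ≠ ⊤ := by
        rintro rfl
        rw [top_add] at hsum
        exact (ENNReal.add_ne_top.2 ⟨hP, ENNReal.mul_ne_top ENNReal.coe_ne_top
          ENNReal.coe_ne_top⟩) hsum.symm
      lift P to NNReal using hP
      lift I to NNReal using hI
      have hsum' : (I : ℝ) + N = P + K * Ω := by exact_mod_cast hsum
      have e1 : ((P : ENNReal) : EReal) - ((N : ENNReal) : EReal) = (((P : ℝ) - N : ℝ) : EReal) := by
        push_cast; rfl
      have e2 : ((Ω : ENNReal) : EReal) * (c : EReal) = (((Ω : ℝ) * c : ℝ) : EReal) := by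
        push_cast; rfl
      rw [e1, e2, EReal.coe_le_coe_iff, ← ENNReal.ofReal_coe_nnreal (p := I),
        ← ENNReal.ofReal_coe_nnreal (p := Ω), ← ENNReal.ofReal_mul hΩ0.le,
        ENNReal.ofReal_le_ofReal_iff (by positivity)]
      constructor <;> intro h <;> nlinarith

/-- The linear isomorphism sending the tuple of columns of a matrix to its vectorization. -/
noncomputable def columnsEquiv (n p : ℕ) :
    (Fin p → EuclideanSpace ℝ (Fin n)) ≃L[ℝ] EuclideanSpace ℝ (Fin (n * p)) :=
  LinearEquiv.toContinuousLinearEquiv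
    { toFun := fun v => vecEquiv n p (Matrix.of fun i j => v j i)
      invFun := fun x => fun j => WithLp.toLp 2 fun i => (vecEquiv n p).symm x i j
      map_add' := fun v w => by ext k; simp [vecEquiv, Matrix.vec]
      map_smul' := fun a v => by ext k; simp [vecEquiv, Matrix.vec]
      left_inv := fun v => by ext j i; simp
      right_inv := fun x => by
        ext k
        simp [vecEquiv, Matrix.vec] }

theorem columnsEquiv_apply (n p : ℕ) (v : Fin p → EuclideanSpace ℝ (Fin n)) :
    columnsEquiv n p v = vecEquiv n p (Matrix.of fun i j => v j i) := rfl

theorem norm_sq_columnsEquiv (n p : ℕ) (v : Fin p → EuclideanSpace ℝ (Fin n)) :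
    ‖columnsEquiv n p v‖ ^ 2 = ∑ j, ‖v j‖ ^ 2 := by
  simp only [EuclideanSpace.norm_sq_eq]
  rw [← Fintype.sum_prod_type', ← (vecIndex n p).sum_comp]
  simp [columnsEquiv_apply, vecEquiv, Matrix.vec]

theorem continuous_vecEquiv_symm (n p : ℕ) : Continuous (vecEquiv n p).symm := by
  refine continuous_matrix fun i j => ?_
  exact (EuclideanSpace.proj (𝕜 := ℝ) (vecIndex n p (j, i))).continuous

theorem vecEquiv_symm_columnsEquiv_add_single (n p : ℕ) (v : Fin p → EuclideanSpace ℝ (Fin n))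
    (j : Fin p) (s : ℝ) (e : EuclideanSpace ℝ (Fin n)) :
    (vecEquiv n p).symm (columnsEquiv n p v + columnsEquiv n p (Pi.single j (s • e)))
      = (vecEquiv n p).symm (columnsEquiv n p v)
        + Matrix.vecMulVec e.ofLp (Pi.single j s) := by
  rw [← map_add, columnsEquiv_apply, columnsEquiv_apply, Equiv.symm_apply_apply,
    Equiv.symm_apply_apply]
  ext i k
  by_cases hk : k = j
  · subst hk; simp [Matrix.vecMulVec, mul_comm]
  · simp [Matrix.vecMulVec, hk]

theorem surfaceMeasure_univ_ne_zero {d : ℕ} (hd : 1 ≤ d) : surfaceMeasure d Set.univ ≠ 0 := by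
  have : Nonempty (Fin d) := ⟨⟨0, hd⟩⟩
  rw [Ne, Measure.measure_univ_eq_zero]
  exact Measure.toSphere_ne_zero _

instance (d : ℕ) : IsFiniteMeasure (surfaceMeasure d) := by
  unfold surfaceMeasure; infer_instance

/-- A real lower bound on a compact set for a lower semicontinuous function without the value
`-∞`. -/
theorem exists_neg_le_of_isCompact {X : Type*} [TopologicalSpace X] {g : X → EReal}
    (hg : LowerSemicontinuous g) (hbot : ∀ x, g x ≠ ⊥) {S : Set X} (hS : IsCompact S) :
    ∃ K : NNReal, ∀ x ∈ S, -((K : ℝ) : EReal) ≤ g x := by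
  rcases S.eq_empty_or_nonempty with rfl | hne
  · exact ⟨0, by simp⟩
  obtain ⟨x₀, -, hmin⟩ := (hg.lowerSemicontinuousOn S).exists_isMinOn hne hS
  obtain ⟨q, -, hq⟩ := EReal.lt_iff_exists_real_btwn.1 (bot_lt_iff_ne_bot.2 (hbot x₀))
  refine ⟨(-q).toNNReal, fun x hx => le_trans ?_ (hq.le.trans (hmin hx))⟩
  rw [← EReal.coe_neg, EReal.coe_le_coe_iff]
  have := Real.le_coe_toNNReal (-q)
  linarith

/-- Spherical mean value inequalities in terms of rotation averages of the shifted function. -/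
theorem extIntegral_surfaceMeasure_div_le_iff {d : ℕ} (hd : 1 ≤ d)
    {h : EuclideanSpace ℝ (Fin d) → EReal} (hh : Measurable h) {K : NNReal} {s : ℝ}
    (hK : ∀ y, ‖y‖ = |s| → -((K : ℝ) : EReal) ≤ h y) {c : EReal} (hc : -((K : ℝ) : EReal) ≤ c)
    {x : EuclideanSpace ℝ (Fin d)} (hx : ‖x‖ = |s|) :
    extIntegral (surfaceMeasure d) (fun e : UnitSphere d => h (s • (e : EuclideanSpace ℝ (Fin d))))
        / (sphereArea d : EReal) ≤ c ↔
      rotationAverage (fun y => (h y + ((K : ℝ) : EReal)).toENNReal) x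
        ≤ (c + ((K : ℝ) : EReal)).toENNReal := by
  rw [sphereArea, extIntegral_div_le_iff (surfaceMeasure_univ_ne_zero hd)
    (g := fun e : UnitSphere d => h (s • (e : EuclideanSpace ℝ (Fin d))))
    (hh.comp (measurable_subtype_coe.const_smul s)) (fun e => hK _ (by simp [norm_smul])) hc,
    ← ENNReal.mul_le_mul_iff_right (b := rotationAverage _ x) (surfaceMeasure_univ_ne_zero hd)
      (measure_ne_top _ _)]
  simp only [surfaceMeasure]
  rw [lintegral_toSphere_eq_rotationAverage (hh.add_const _).ereal_toENNReal hx]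

theorem mainTheorem12 (n p : ℕ) (hn : 1 ≤ n) (hp : 1 ≤ p)
    (f : Matrix (Fin n) (Fin p) ℝ → EReal) (hf : IsMatrixSuperharmonic f) :
    IsSuperharmonic (f ∘ (vecEquiv n p).symm) := by
  set g : EuclideanSpace ℝ (Fin (n * p)) → EReal := f ∘ (vecEquiv n p).symm with hgdef
  have hg : LowerSemicontinuous g := hf.lowerSemicontinuous.comp (continuous_vecEquiv_symm n p)
  have hbot : ∀ x, g x ≠ ⊥ := fun x => hf.ne_bot _
  have hnp : 1 ≤ n * p := Nat.mul_pos hn hp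
  have hne : Nonempty (Fin (n * p)) := ⟨⟨0, hnp⟩⟩
  refine ⟨hbot, hg, ?_, fun c r hr => ?_⟩
  · obtain ⟨X, hX⟩ := hf.exists_ne_top
    exact ⟨vecEquiv n p X, by simpa [g] using hX⟩
  -- The extra `1` in the radius leaves room for the column spheres around points near the sphere of
  -- radius `r`.
  obtain ⟨K, hK⟩ := exists_neg_le_of_isCompact hg hbot (isCompact_closedBall c (r + 1))
  have hKc : ∀ y, ‖y‖ ≤ r + 1 → -((K : ℝ) : EReal) ≤ g (c + y) := fun y hy =>
    hK _ (by simpa using hy)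
  obtain ⟨x, hx⟩ := exists_norm_eq (EuclideanSpace ℝ (Fin (n * p))) hr.le
  have habs : |r| = r := abs_of_pos hr
  refine (extIntegral_surfaceMeasure_div_le_iff hnp (h := fun y => g (c + y))
    (hg.measurable.comp (measurable_const_add c)) (K := K)
    (fun y hy => hKc y (by rw [hy, habs]; linarith))
    (by simpa using hKc 0 (by simpa using by linarith)) (hx.trans habs.symm)).2 ?_
  -- Outside that ball `toENNReal` may truncate; this is harmless because the column inequalities
  -- are only required inside it.
  have hu : LowerSemicontinuous fun y => (g y + ((K : ℝ) : EReal)).toENNReal := by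
    have hcont : Continuous fun z : EReal => (z + ((K : ℝ) : EReal)).toENNReal := by
      refine EReal.continuous_toENNReal.comp ?_
      refine continuous_iff_continuousAt.2 fun z => ?_
      exact (EReal.continuousAt_add (p := (z, ((K : ℝ) : EReal))) (by simp) (by simp)).comp
        (f := fun z => (z, ((K : ℝ) : EReal))) (by fun_prop)
    exact hcont.comp_lowerSemicontinuous hg fun a b hab =>
      EReal.toENNReal_le_toENNReal (add_le_add_left hab _)
  refine rotationAverage_le_of_columns (columnsEquiv n p) (norm_sq_columnsEquiv n p) hu c hr
    (lt_add_one r) (fun v j a hva => ?_) hx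
  have hsingle : ∀ y, ‖columnsEquiv n p (Pi.single j y)‖ = ‖y‖ := fun y => by
    have h := norm_sq_columnsEquiv n p (Pi.single j y)
    rw [Finset.sum_eq_single j (fun i _ hi => by simp [hi]) (by simp), Pi.single_eq_same] at h
    exact (sq_eq_sq₀ (norm_nonneg _) (norm_nonneg _)).1 h
  have hKv : ∀ y, ‖y‖ ≤ ‖a‖ →
      -((K : ℝ) : EReal) ≤ g (columnsEquiv n p v + columnsEquiv n p (Pi.single j y)) := by
    intro y hy
    refine hK _ ?_
    rw [mem_closedBall_iff_norm, add_sub_right_comm]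
    refine (norm_add_le _ _).trans ?_
    rw [hsingle]
    linarith
  have hmeas : Measurable fun y =>
      g (columnsEquiv n p v + columnsEquiv n p (Pi.single j y)) := by
    refine hg.measurable.comp (Continuous.measurable ?_)
    exact continuous_const.add ((columnsEquiv n p).continuous.comp 
      (continuous_single (A := fun _ : Fin p => EuclideanSpace ℝ (Fin n)) j))
  refine (extIntegral_surfaceMeasure_div_le_iff hn hmeas (K := K) (s := ‖a‖)
    (fun y hy => hKv y (by rw [hy, abs_norm])) (by simpa using hKv 0 (by simp))
    (abs_norm a).symm).1 ?_
  -- With `ρ = ‖a‖ e_j`, the matrix `e ρᵀ` has `‖a‖ e` as column `j` and zeros elsewhere; `a = 0` is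
  -- covered since `ρ = 0` is allowed.
  have h := hf.matrixSphereAverage_le ((vecEquiv n p).symm (columnsEquiv n p v)) (Pi.single j ‖a‖)
  simpa only [matrixSphereAverage, g, Function.comp_apply,
    vecEquiv_symm_columnsEquiv_add_single] using h
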